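/- Let $\Omega\subset\mathbb{R}^d$ be a bounded domain (nonempty, open, connected) with Lipschitz boundary, and let $V\subset H^1(\Omega)$ be a closed subspace with $H^1_0(\Omega)\subset V$. Let $\tilde\alpha,\tilde\sigma:\Omega\to\mathbb{R}$ be measurable with $0<\tilde\alpha_{\min}\le\tilde\alpha\le\tilde\alpha_{\max}<\infty$ and $0\le\tilde\sigma\le\|\tilde\sigma\|_{L^\infty(\Omega)}<\infty$ almost everywhere, let $\tilde f\in L^2(\Omega)$, let $m\ge 1$, let $B_1,\dots,B_m\subset\Omega$ be open and nonempty, and let $\delta>0$. Write $|U|$ for the Lebesgue measure of $U$ and $\langle v\rangle_U=|U|^{-1}\int_U v\,dx$. For $w,v\in H^1(\Omega)$ and $b=(b_1,\dots,b_m)\in\mathbb{R}^m$ define $$\tilde a(w,v)=\int_\Omega \tilde\alpha\,\nabla w\cdot\nabla v+\tilde\sigma\, w v\,dx,\qquad \tilde\ell(v)=\int_\Omega \tilde f v\,dx,$$ $$\tilde c(w,v)=\tilde a(w,v)+\delta^{-1}\sum_{i=1}^m |B_i|\langle w\rangle_{B_i}\,\langle v\rangle_{B_i},\qquad \tilde r_b(v)=\tilde\ell(v)+\delta^{-1}\sum_{i=1}^m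 b_i\,|B_i|\,\langle v\rangle_{B_i},$$ $$\tilde J_b(v)=\tfrac12\tilde c(v,v)-\tilde r_b(v).$$ Then: 1. For every $b\in\mathbb{R}^m$, an element $\tilde u\in V$ minimizes $\tilde J_b$ over $V$ if and only if $\tilde c(\tilde u,v)=\tilde r_b(v)$ for all $v\in V$. 2. For every $b\in\mathbb{R}^m$ this problem has exactly one solution $\tilde u=\tilde u_b\in V$. 3. The solution depends Lipschitz-continuously on the data: there is a constant $L\ge 0$ such that $\|\tilde u_b-\tilde u_{b'}\|_{H^1(\Omega)}\le L\,|b-b'|$ for all $b,b'\in\mathbb{R}^m$. -/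

import Mathlib

open MeasureTheory
open scoped ContDiff RealInnerProductSpace

noncomputable section

namespace PDEReg

/-- Euclidean space `ℝ^d` with the Euclidean norm. -/
abbrev Eucl (d : ℕ) : Type := EuclideanSpace ℝ (Fin d)

/-- `Ω` has a Lipschitz boundary: near every boundary point there is a unit direction `e` such that
`Ω` is, locally, the set of points lying strictly above the graph of a Lipschitz function `φ` over
the hyperplane orthogonal to `e` (the point `x` has height `⟪e, x⟫` over its orthogonal projection
`x - ⟪e, x⟫ • e` to that hyperplane). -/
def HasLipschitzBoundary {d : ℕ} (Ω : Set (Eucl d)) : Prop :=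
  ∀ p ∈ frontier Ω, ∃ (e : Eucl d) (φ : Eucl d → ℝ) (K : NNReal) (U : Set (Eucl d)),
    ‖e‖ = 1 ∧ LipschitzWith K φ ∧ IsOpen U ∧ p ∈ U ∧
      ∀ x ∈ U, x ∈ Ω ↔ φ (x - ⟪e, x⟫ • e) < ⟪e, x⟫

/-- A bounded Lipschitz domain: a nonempty, connected, open, bounded set with Lipschitz boundary. -/
structure IsBoundedLipschitzDomain {d : ℕ} (Ω : Set (Eucl d)) : Prop where
  isOpen : IsOpen Ω
  isConnected : IsConnected Ω
  isBounded : Bornology.IsBounded Ω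
  lipschitz : HasLipschitzBoundary Ω

/-- Test functions: `C_c^∞(Ω)`. -/
structure IsTestFunction {d : ℕ} (Ω : Set (Eucl d)) (φ : Eucl d → ℝ) : Prop where
  smooth : ContDiff ℝ ∞ φ
  hasCompactSupport : HasCompactSupport φ
  tsupport_subset : tsupport φ ⊆ Ω

/-- `g` is the weak gradient of `u` in `Ω`:
`∫_Ω u ∂ᵢφ = - ∫_Ω gᵢ φ` for all `φ ∈ C_c^∞(Ω)` and all coordinates `i`. -/
def IsWeakGradient {d : ℕ} (Ω : Set (Eucl d)) (u : Eucl d → ℝ) (g : Eucl d → Eucl d) : Prop :=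
  ∀ φ : Eucl d → ℝ, IsTestFunction Ω φ → ∀ i : Fin d,
    ∫ x in Ω, u x * fderiv ℝ φ x (EuclideanSpace.single i 1) = - ∫ x in Ω, g x i * φ x

/-- `L²(Ω) × L²(Ω; ℝ^d)` with the Hilbert norm `(‖u‖² + ‖g‖²)^{1/2}`. -/
abbrev L2Pair {d : ℕ} (Ω : Set (Eucl d)) : Type :=
  WithLp 2 (Lp ℝ 2 (volume.restrict Ω) × Lp (Eucl d) 2 (volume.restrict Ω))

lemma IsTestFunction.memLp {d : ℕ} {Ω : Set (Eucl d)} {φ : Eucl d → ℝ} (h : IsTestFunction Ω φ) :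
    MemLp φ 2 (volume.restrict Ω) :=
  h.smooth.continuous.memLp_of_hasCompactSupport h.hasCompactSupport

lemma IsTestFunction.memLp_fderiv {d : ℕ} {Ω : Set (Eucl d)} {φ : Eucl d → ℝ}
    (h : IsTestFunction Ω φ) (v : Eucl d) :
    MemLp (fun x => fderiv ℝ φ x v) 2 (volume.restrict Ω) := by
  have hc : Continuous (fun x => fderiv ℝ φ x v) :=
    (h.smooth.continuous_fderiv (by simp)).clm_apply continuous_const
  exact hc.memLp_of_hasCompactSupport (h.hasCompactSupport.fderiv_apply ℝ v)

lemma memLp_coord {d : ℕ} {Ω : Set (Eucl d)} (g : Lp (Eucl d) 2 (volume.restrict Ω)) (i : Fin d) :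
    MemLp (fun x => g x i) 2 (volume.restrict Ω) :=
  (EuclideanSpace.proj (𝕜 := ℝ) i).comp_memLp' (Lp.memLp g)

/-- The Sobolev space `H¹(Ω)`, each `u ∈ L²(Ω)` with a (necessarily unique) weak gradient
`∇u ∈ L²(Ω; ℝ^d)` being stored as the pair `(u, ∇u)`; the norm inherited from `L2Pair Ω` is the
usual norm `(‖u‖² + ‖∇u‖²)^{1/2}`. -/
def H1 {d : ℕ} (Ω : Set (Eucl d)) : Submodule ℝ (L2Pair Ω) where
  carrier := {w | IsWeakGradient Ω w.fst w.snd}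
  zero_mem' := by
    intro φ hφ i
    have h1 : ∫ x in Ω, ((0 : L2Pair Ω).fst : Eucl d → ℝ) x *
        fderiv ℝ φ x (EuclideanSpace.single i 1) = 0 := by
      refine integral_eq_zero_of_ae ?_
      filter_upwards [Lp.coeFn_zero ℝ 2 (volume.restrict Ω)] with x hx
      rw [WithLp.zero_fst, hx]
      simp
    have h2 : ∫ x in Ω, ((0 : L2Pair Ω).snd : Eucl d → Eucl d) x i * φ x = 0 := by
      refine integral_eq_zero_of_ae ?_
      filter_upwards [Lp.coeFn_zero (Eucl d) 2 (volume.restrict Ω)] with x hx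
      rw [WithLp.zero_snd, hx]
      simp
    rw [h1, h2, neg_zero]
  add_mem' := by
    intro a b ha hb φ hφ i
    have h1 : ∫ x in Ω, ((a + b).fst : Eucl d → ℝ) x * fderiv ℝ φ x (EuclideanSpace.single i 1) =
        (∫ x in Ω, (a.fst : Eucl d → ℝ) x * fderiv ℝ φ x (EuclideanSpace.single i 1)) +
        ∫ x in Ω, (b.fst : Eucl d → ℝ) x * fderiv ℝ φ x (EuclideanSpace.single i 1) := by
      refine (integral_congr_ae ?_).trans (integral_add
        ((Lp.memLp a.fst).integrable_mul (hφ.memLp_fderiv _))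
        ((Lp.memLp b.fst).integrable_mul (hφ.memLp_fderiv _)))
      filter_upwards [Lp.coeFn_add a.fst b.fst] with x hx
      rw [WithLp.add_fst, hx]
      simp [add_mul]
    have h2 : ∫ x in Ω, ((a + b).snd : Eucl d → Eucl d) x i * φ x =
        (∫ x in Ω, (a.snd : Eucl d → Eucl d) x i * φ x) +
        ∫ x in Ω, (b.snd : Eucl d → Eucl d) x i * φ x := by
      refine (integral_congr_ae ?_).trans (integral_add
        ((memLp_coord a.snd i).integrable_mul hφ.memLp)
        ((memLp_coord b.snd i).integrable_mul hφ.memLp))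
      filter_upwards [Lp.coeFn_add a.snd b.snd] with x hx
      rw [WithLp.add_snd, hx]
      simp [add_mul]
    rw [h1, h2, ha φ hφ i, hb φ hφ i, neg_add]
  smul_mem' := by
    intro c a ha φ hφ i
    have h1 : ∫ x in Ω, ((c • a).fst : Eucl d → ℝ) x * fderiv ℝ φ x (EuclideanSpace.single i 1) =
        c * ∫ x in Ω, (a.fst : Eucl d → ℝ) x * fderiv ℝ φ x (EuclideanSpace.single i 1) := by
      rw [← integral_const_mul]
      refine integral_congr_ae ?_
      filter_upwards [Lp.coeFn_smul c a.fst] with x hx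
      simp [hx, mul_assoc]
    have h2 : ∫ x in Ω, ((c • a).snd : Eucl d → Eucl d) x i * φ x =
        c * ∫ x in Ω, (a.snd : Eucl d → Eucl d) x i * φ x := by
      rw [← integral_const_mul]
      refine integral_congr_ae ?_
      filter_upwards [Lp.coeFn_smul c a.snd] with x hx
      simp [hx, mul_assoc]
    rw [h1, h2, ha φ hφ i, mul_neg]

/-- The function `u ∈ L²(Ω)` underlying an element of `H¹(Ω)`. -/
def fn {d : ℕ} {Ω : Set (Eucl d)} (u : H1 Ω) : Lp ℝ 2 (volume.restrict Ω) :=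
  (u : L2Pair Ω).fst

/-- The weak gradient `∇u ∈ L²(Ω; ℝ^d)` of an element of `H¹(Ω)`. -/
def grad {d : ℕ} {Ω : Set (Eucl d)} (u : H1 Ω) : Lp (Eucl d) 2 (volume.restrict Ω) :=
  (u : L2Pair Ω).snd

/-- `H¹₀(Ω)`: the closure of `C_c^∞(Ω)` in `H¹(Ω)` (the elements of `H¹(Ω)` that are represented by
test functions already form a subspace). -/
def H10 {d : ℕ} (Ω : Set (Eucl d)) : Submodule ℝ (H1 Ω) :=
  (Submodule.span ℝ {u : H1 Ω | ∃ φ : Eucl d → ℝ, IsTestFunction Ω φ ∧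
    (fn u : Eucl d → ℝ) =ᵐ[volume.restrict Ω] φ}).topologicalClosure

/-- `ã(w,v) = ∫_Ω α ∇w·∇v + σ w v`. -/
def aForm {d : ℕ} (Ω : Set (Eucl d)) (α σ : Eucl d → ℝ) (w v : H1 Ω) : ℝ :=
  ∫ x in Ω, (α x * ⟪grad w x, grad v x⟫ + σ x * fn w x * fn v x)

/-- `ℓ̃(v) = ∫_Ω f v`. -/
def load {d : ℕ} (Ω : Set (Eucl d)) (f : Eucl d → ℝ) (v : H1 Ω) : ℝ :=
  ∫ x in Ω, f x * fn v x

/-- `b(w,v) = ∑ᵢ |Bᵢ| (⨍_{Bᵢ} w) (⨍_{Bᵢ} v)`. -/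
def bForm {d m : ℕ} (Ω : Set (Eucl d)) (B : Fin m → Set (Eucl d)) (w v : H1 Ω) : ℝ :=
  ∑ i, volume.real (B i) * (⨍ x in B i, fn w x) * (⨍ x in B i, fn v x)

/-- The data functional `v ↦ ∑ᵢ bᵢ |Bᵢ| ⨍_{Bᵢ} v`. -/
def dataTerm {d m : ℕ} (Ω : Set (Eucl d)) (B : Fin m → Set (Eucl d))
    (b : EuclideanSpace ℝ (Fin m)) (v : H1 Ω) : ℝ :=
  ∑ i, b i * volume.real (B i) * (⨍ x in B i, fn v x)

/-- `c̃(w,v) = ã(w,v) + δ⁻¹ b(w,v)`. -/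
def cForm {d m : ℕ} (Ω : Set (Eucl d)) (α σ : Eucl d → ℝ) (B : Fin m → Set (Eucl d)) (δ : ℝ)
    (w v : H1 Ω) : ℝ :=
  aForm Ω α σ w v + δ⁻¹ * bForm Ω B w v

/-- `r̃(v) = ℓ̃(v) + δ⁻¹ ∑ᵢ bᵢ |Bᵢ| ⨍_{Bᵢ} v`. -/
def rhs {d m : ℕ} (Ω : Set (Eucl d)) (f : Eucl d → ℝ) (B : Fin m → Set (Eucl d)) (δ : ℝ)
    (b : EuclideanSpace ℝ (Fin m)) (v : H1 Ω) : ℝ :=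
  load Ω f v + δ⁻¹ * dataTerm Ω B b v

/-- The functional `J̃(v) = ½ c̃(v,v) - r̃(v)`. -/
def energy {d m : ℕ} (Ω : Set (Eucl d)) (α σ f : Eucl d → ℝ) (B : Fin m → Set (Eucl d)) (δ : ℝ)
    (b : EuclideanSpace ℝ (Fin m)) (v : H1 Ω) : ℝ :=
  (1 / 2 : ℝ) * cForm Ω α σ B δ v v - rhs Ω f B δ b v

/-- `u` solves the PDE-regularized learning problem: `u ∈ V` minimizes `J̃` over `V`. -/
def IsMinimizer {d m : ℕ} (Ω : Set (Eucl d)) (V : Submodule ℝ (H1 Ω)) (α σ f : Eucl d → ℝ)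
    (B : Fin m → Set (Eucl d)) (δ : ℝ) (b : EuclideanSpace ℝ (Fin m)) (u : H1 Ω) : Prop :=
  u ∈ V ∧ ∀ v ∈ V, energy Ω α σ f B δ b u ≤ energy Ω α σ f B δ b v

/-- `u` solves the variational equation: `u ∈ V` and `c̃(u,v) = r̃(v)` for all `v ∈ V`. -/
def IsVariationalSolution {d m : ℕ} (Ω : Set (Eucl d)) (V : Submodule ℝ (H1 Ω))
    (α σ f : Eucl d → ℝ) (B : Fin m → Set (Eucl d)) (δ : ℝ) (b : EuclideanSpace ℝ (Fin m))
    (u : H1 Ω) : Prop :=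
  u ∈ V ∧ ∀ v ∈ V, cForm Ω α σ B δ u v = rhs Ω f B δ b v

end PDEReg

end

/-!
The bilinear form `c̃` is bounded and symmetric on the Hilbert space `H¹(Ω)`, so once it is coercive
everything follows from the Lax–Milgram theorem and the first variation of a quadratic functional
(`quadratic_minimization_wellPosed`). Coercivity is the real content: `σ` may vanish, so the `L²`
norm of `u` has to be recovered from `∇u` and the mean of `u` over one set `Bᵢ`. This is a
Poincaré inequality (`IsBoundedLipschitzDomain.exists_norm_fn_sq_le`), proved here without
compact embeddings.

The basic tool is the translation estimate `lintegral_translate_sub_le`,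
`‖u(· + h) - u‖_{L²(D)} ≤ |h| ‖∇u‖_{L²(Ω)}`, valid when all segments `[x, x + h]`, `x ∈ D`, lie in
`Ω`. It is obtained by duality: paired with a test function `φ`, the left side is the increment of
`t ↦ ∫ u(y) φ(y - t h) dy`, whose derivative the weak gradient computes, and test functions are dense
in `L²(D)`.

Call `D` and `E` linked (`OscBound Ω D E`) if `∫_D ∫_E |u(x) - u(y)|² ≤ C ‖∇u‖²` uniformly in `u`.
Integrating the translation estimate over `h` links a ball in `Ω` to itself. Linking is transitive
through open sets, by averaging over the intermediate point. At a boundary point, shifting along the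
axis of the Lipschitz graph moves a piece of `Ω` into a ball inside `Ω`, which links the piece to
that ball. Connectedness of `Ω` links every small ball to a fixed one, and compactness of the closure
then links `Ω` to itself. Since the mean is the closest constant in mean square, the Poincaré
inequality with the mean over `Bᵢ` follows.
-/

open Set Filter Topology
open scoped ENNReal NNReal

noncomputable section

namespace PDEReg

-- nested spaces of continuous linear maps on `H1 Ω` need deeper instance unification
set_option maxSynthPendingDepth 3

variable {d : ℕ} {Ω D E F : Set (Eucl d)}

/-! ### Translation estimate by duality with test functions -/

lemma IsTestFunction.eq_zero_of_notMem {φ : Eucl d → ℝ} (hφ : IsTestFunction D φ) {x : Eucl d}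
    (hx : x ∉ D) : φ x = 0 :=
  image_eq_zero_of_notMem_tsupport fun h => hx (hφ.tsupport_subset h)

/-- The classes in `L²(D)` that are represented by test functions. -/
def testSubmodule (D : Set (Eucl d)) : Submodule ℝ (Lp ℝ 2 (volume.restrict D)) where
  carrier := {v | ∃ φ, IsTestFunction D φ ∧ v =ᵐ[volume.restrict D] φ}
  zero_mem' := ⟨0, ⟨contDiff_const, HasCompactSupport.zero, by simp [tsupport]⟩, Lp.coeFn_zero _ _ _⟩
  add_mem' := by
    rintro a b ⟨φ, hφ, ha⟩ ⟨ψ, hψ, hb⟩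
    refine ⟨φ + ψ, ⟨hφ.smooth.add hψ.smooth, hφ.hasCompactSupport.add hψ.hasCompactSupport,
      (tsupport_add φ ψ).trans (union_subset hφ.tsupport_subset hψ.tsupport_subset)⟩, ?_⟩
    exact (Lp.coeFn_add a b).trans (ha.add hb)
  smul_mem' := by
    rintro c a ⟨φ, hφ, ha⟩
    refine ⟨c • φ, ⟨hφ.smooth.const_smul c, hφ.hasCompactSupport.smul_left (f := fun _ => c),
      (tsupport_smul_subset_right (fun _ => c) φ).trans hφ.tsupport_subset⟩, ?_⟩
    exact (Lp.coeFn_smul c a).trans (ha.const_smul c)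

lemma topologicalClosure_testSubmodule (hD : IsOpen D) :
    (testSubmodule D).topologicalClosure = ⊤ := by
  rw [Submodule.topologicalClosure_eq_top_iff, Submodule.eq_bot_iff]
  intro v hv
  have hloc : LocallyIntegrableOn v D volume :=
    locallyIntegrableOn_of_locallyIntegrable_restrict ((Lp.memLp v).locallyIntegrable (by norm_num))
  have h := hD.ae_eq_zero_of_integral_contDiff_smul_eq_zero hloc (μ := volume)
    (fun φ h1 h2 h3 => by
      have hφ : IsTestFunction D φ := ⟨h1, h2, h3⟩
      have := (Submodule.mem_orthogonal _ _).1 hv (hφ.memLp.toLp φ)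
        ⟨φ, hφ, hφ.memLp.coeFn_toLp⟩
      rw [L2.inner_def] at this
      rw [← setIntegral_eq_integral_of_forall_compl_eq_zero (s := D)
        (fun x hx => by simp [hφ.eq_zero_of_notMem hx]), ← this]
      refine integral_congr_ae ?_
      filter_upwards [hφ.memLp.coeFn_toLp] with x hx
      simp [hx, mul_comm])
  have h0 : v =ᵐ[volume.restrict D] 0 := (ae_restrict_iff' hD.measurableSet).2 h
  exact Lp.ext (h0.trans (Lp.coeFn_zero _ _ _).symm)

/-- The `L²(D)` norm of a function is its norm as a functional on test functions. -/
lemma norm_toLp_le_of_forall_testFunction (hD : IsOpen D) {G : Eucl d → ℝ}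
    (hG : MemLp G 2 (volume.restrict D)) {A : ℝ} (hA : 0 ≤ A)
    (h : ∀ φ : Eucl d → ℝ, IsTestFunction D φ →
      |∫ x in D, G x * φ x| ≤ A * (eLpNorm φ 2 (volume.restrict D)).toReal) :
    ‖hG.toLp G‖ ≤ A := by
  have key : ∀ v : Lp ℝ 2 (volume.restrict D), |⟪hG.toLp G, v⟫| ≤ A * ‖v‖ := by
    intro v
    have hv : v ∈ closure (testSubmodule D : Set (Lp ℝ 2 (volume.restrict D))) := by
      rw [← Submodule.topologicalClosure_coe, topologicalClosure_testSubmodule hD]; trivial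
    refine closure_minimal (t := {v | |⟪hG.toLp G, v⟫| ≤ A * ‖v‖}) ?_
      (isClosed_le (by fun_prop) (by fun_prop)) hv
    rintro v ⟨φ, hφ, hvφ⟩
    have e1 : ⟪hG.toLp G, v⟫ = ∫ x in D, G x * φ x := by
      rw [L2.inner_def]
      refine integral_congr_ae ?_
      filter_upwards [hG.coeFn_toLp, hvφ] with x h1 h2
      simp [h1, h2, mul_comm]
    change |⟪hG.toLp G, v⟫| ≤ A * ‖v‖
    rw [e1, Lp.norm_def, eLpNorm_congr_ae hvφ]
    exact h φ hφ
  have h1 := key (hG.toLp G)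
  rw [real_inner_self_eq_norm_sq, abs_of_nonneg (sq_nonneg _), sq] at h1
  rcases eq_or_ne (hG.toLp G) 0 with h0 | h0
  · simpa [h0] using hA
  · exact le_of_mul_le_mul_right h1 (norm_pos_iff.2 h0)

/-- Integration by parts in an arbitrary direction `h`. -/
lemma integral_mul_fderiv_eq (w : H1 Ω) {ψ : Eucl d → ℝ} (hψ : IsTestFunction Ω ψ) (h : Eucl d) :
    ∫ x in Ω, fn w x * fderiv ℝ ψ x h = -∫ x in Ω, ⟪h, grad w x⟫ * ψ x := by
  have hw : IsWeakGradient Ω (fn w) (grad w) := w.2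
  have hh : h = ∑ i, h i • EuclideanSpace.single i (1 : ℝ) := by
    ext j; simp [Pi.single_apply]
  have e1 : ∀ x, fn w x * fderiv ℝ ψ x h =
      ∑ i, h i * (fn w x * fderiv ℝ ψ x (EuclideanSpace.single i 1)) := by
    intro x
    conv_lhs => rw [hh]
    simp only [map_sum, map_smul, smul_eq_mul, Finset.mul_sum]
    exact Finset.sum_congr rfl fun i _ => by ring
  have e2 : ∀ x, ⟪h, grad w x⟫ * ψ x = ∑ i, h i * (grad w x i * ψ x) := by
    intro x
    simp only [PiLp.inner_apply, RCLike.inner_apply, conj_trivial, Finset.sum_mul]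
    exact Finset.sum_congr rfl fun i _ => by ring
  simp only [e1, e2]
  rw [integral_finsetSum, integral_finsetSum, ← Finset.sum_neg_distrib]
  · refine Finset.sum_congr rfl fun i _ => ?_
    rw [integral_const_mul, integral_const_mul, hw ψ hψ i, mul_neg]
  · exact fun i _ => ((memLp_coord (grad w) i).integrable_mul hψ.memLp).const_mul _
  · exact fun i _ => ((Lp.memLp (fn w)).integrable_mul (hψ.memLp_fderiv _)).const_mul _

lemma abs_integral_inner_grad_mul_le (w : H1 Ω) {ψ : Eucl d → ℝ} (hψ : IsTestFunction Ω ψ)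
    (h : Eucl d) :
    |∫ x in Ω, ⟪h, grad w x⟫ * ψ x| ≤
      ‖h‖ * ‖grad w‖ * (eLpNorm ψ 2 (volume.restrict Ω)).toReal := by
  have hm : MemLp (fun x => ⟪h, grad w x⟫) 2 (volume.restrict Ω) :=
    (Lp.memLp (grad w)).const_inner h
  have hn : ‖hm.toLp _‖ ≤ ‖h‖ * ‖grad w‖ := by
    refine Lp.norm_le_mul_norm_of_ae_le_mul ?_
    filter_upwards [hm.coeFn_toLp] with x hx
    rw [hx]
    exact norm_inner_le_norm _ _
  have e : ∫ x in Ω, ⟪h, grad w x⟫ * ψ x = ⟪hm.toLp _, hψ.memLp.toLp ψ⟫ := by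
    rw [L2.inner_def]
    refine integral_congr_ae ?_
    filter_upwards [hm.coeFn_toLp, hψ.memLp.coeFn_toLp] with x h1 h2
    rw [h1, h2]
    simp [mul_comm]
  rw [e, ← Lp.norm_toLp ψ hψ.memLp]
  exact (abs_real_inner_le_norm _ _).trans (by gcongr)

lemma IsTestFunction.comp_sub {φ : Eucl d → ℝ} (hφ : IsTestFunction D φ) {a : Eucl d}
    (ha : ∀ x ∈ D, x + a ∈ Ω) : IsTestFunction Ω (fun y => φ (y - a)) where
  smooth := hφ.smooth.comp (contDiff_id.sub contDiff_const)
  hasCompactSupport := hφ.hasCompactSupport.comp_homeomorph (Homeomorph.subRight a)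
  tsupport_subset := by
    have e : tsupport (fun y => φ (y - a)) = (Homeomorph.subRight a) ⁻¹' tsupport φ :=
      tsupport_comp_eq_preimage φ (Homeomorph.subRight a)
    rw [e]
    intro y hy
    simpa using ha _ (hφ.tsupport_subset hy)

lemma IsTestFunction.eLpNorm_restrict {φ : Eucl d → ℝ} (hφ : IsTestFunction D φ) :
    eLpNorm φ 2 (volume.restrict D) = eLpNorm φ 2 volume :=
  eLpNorm_restrict_eq_of_support_subset ((subset_tsupport φ).trans hφ.tsupport_subset)

lemma eLpNorm_comp_sub {φ : Eucl d → ℝ} (hφ : Continuous φ) (a : Eucl d) :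
    eLpNorm (fun y => φ (y - a)) 2 volume = eLpNorm φ 2 volume :=
  eLpNorm_comp_measurePreserving hφ.aestronglyMeasurable (measurePreserving_sub_right volume a)

/-- Along the segment `t ↦ t • h`, pairing `u` with the translates of a test function has a
derivative which the weak gradient computes, so the total increment is controlled by `∇u`. -/
lemma abs_integral_mul_comp_sub_sub_le (hbdd : Bornology.IsBounded Ω) (w : H1 Ω)
    {φ : Eucl d → ℝ} (hφ : IsTestFunction D φ) {h : Eucl d}
    (hseg : ∀ x ∈ D, ∀ t ∈ Icc (0 : ℝ) 1, x + t • h ∈ Ω) :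
    |(∫ y in Ω, fn w y * φ (y - h)) - ∫ y in Ω, fn w y * φ y| ≤
      ‖h‖ * ‖grad w‖ * (eLpNorm φ 2 volume).toReal := by
  have : IsFiniteMeasure (volume.restrict Ω) := ⟨by
    rw [Measure.restrict_apply_univ]; exact hbdd.measure_lt_top⟩
  have hu : Integrable (fn w) (volume.restrict Ω) := (Lp.memLp (fn w)).integrable (by norm_num)
  have hcf : Continuous (fderiv ℝ φ) := hφ.smooth.continuous_fderiv (by simp)
  obtain ⟨C, hC⟩ := (hφ.hasCompactSupport.fderiv ℝ).exists_bound_of_continuous hcf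
  have hder : ∀ t : ℝ, HasDerivAt (fun t : ℝ => ∫ y in Ω, fn w y * φ (y - t • h))
      (∫ y in Ω, fn w y * fderiv ℝ φ (y - t • h) (-h)) t := by
    intro t
    refine (hasDerivAt_integral_of_dominated_loc_of_deriv_le (s := univ) univ_mem
      (F := fun t y => fn w y * φ (y - t • h))
      (F' := fun t y => fn w y * fderiv ℝ φ (y - t • h) (-h))
      (bound := fun y => ‖fn w y‖ * (C * ‖h‖)) ?_ ?_ ?_ ?_ ?_ ?_).2
    · refine Eventually.of_forall fun s => hu.aestronglyMeasurable.mul ?_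
      exact (hφ.smooth.continuous.comp (by fun_prop)).aestronglyMeasurable
    · obtain ⟨C', hC'⟩ := hφ.hasCompactSupport.exists_bound_of_continuous hφ.smooth.continuous
      exact hu.mul_bdd (c := C')
        (hφ.smooth.continuous.comp (by fun_prop)).aestronglyMeasurable
        (Eventually.of_forall fun y => hC' _)
    · refine hu.aestronglyMeasurable.mul ?_
      exact ((hcf.comp (by fun_prop)).clm_apply continuous_const).aestronglyMeasurable
    · refine Eventually.of_forall fun y s _ => ?_
      rw [norm_mul]
      gcongr
      refine (ContinuousLinearMap.le_opNorm _ _).trans ?_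
      rw [norm_neg]
      gcongr
      exact hC _
    · exact hu.norm.mul_const _
    · refine Eventually.of_forall fun y s _ => ?_
      have h1 : HasDerivAt (fun s : ℝ => y - s • h) (-h) s := by
        simpa using ((hasDerivAt_id s).smul_const h).const_sub y
      have h2 : HasFDerivAt φ (fderiv ℝ φ (y - s • h)) (y - s • h) :=
        (hφ.smooth.differentiable (by simp) _).hasFDerivAt
      exact (h2.comp_hasDerivAt s h1).const_mul _
  have := norm_image_sub_le_of_norm_deriv_le_segment_01'
    (C := ‖h‖ * ‖grad w‖ * (eLpNorm φ 2 volume).toReal)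
    (fun t _ => (hder t).hasDerivWithinAt) (fun t ht => ?_)
  · simpa using this
  · have hψ : IsTestFunction Ω (fun y => φ (y - t • h)) :=
      hφ.comp_sub fun x hx => hseg x hx t ⟨ht.1, ht.2.le⟩
    have e : ∀ y, fderiv ℝ φ (y - t • h) = fderiv ℝ (fun y => φ (y - t • h)) y := fun y => by
      rw [fderiv_comp_sub]
    simp only [e]
    rw [integral_mul_fderiv_eq w hψ, norm_neg, Real.norm_eq_abs]
    refine (abs_integral_inner_grad_mul_le w hψ _).trans (le_of_eq ?_)
    rw [norm_neg, hψ.eLpNorm_restrict, eLpNorm_comp_sub hφ.smooth.continuous]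

/-- Translation estimate: if all segments `[x, x + h]` with `x ∈ D` lie in `Ω`, then
`‖u(· + h) - u‖_{L²(D)} ≤ |h| ‖∇u‖_{L²(Ω)}`. -/
lemma lintegral_translate_sub_le (hΩ : MeasurableSet Ω) (hbdd : Bornology.IsBounded Ω)
    (hD : IsOpen D) {h : Eucl d} (hseg : ∀ x ∈ D, ∀ t ∈ Icc (0 : ℝ) 1, x + t • h ∈ Ω) (w : H1 Ω) :
    ∫⁻ x in D, ‖fn w (x + h) - fn w x‖ₑ ^ 2 ≤ ‖h‖ₑ ^ 2 * ‖grad w‖ₑ ^ 2 := by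
  have hDΩ : D ⊆ Ω := fun x hx => by simpa using hseg x hx 0 (by simp)
  have hDh : D ⊆ (fun x => x + h) ⁻¹' Ω := fun x hx => by simpa using hseg x hx 1 (by simp)
  have hmp := measurePreserving_add_right (volume : Measure (Eucl d)) h
  have hm0 : MemLp (fn w) 2 (volume.restrict D) :=
    (Lp.memLp (fn w)).mono_measure (Measure.restrict_mono hDΩ le_rfl)
  have hm1 : MemLp (fun x => fn w (x + h)) 2 (volume.restrict D) :=
    ((Lp.memLp (fn w)).comp_measurePreserving (hmp.restrict_preimage hΩ)).mono_measure
      (Measure.restrict_mono hDh le_rfl)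
  have hG : MemLp (fun x => fn w (x + h) - fn w x) 2 (volume.restrict D) := hm1.sub hm0
  have hle : ‖hG.toLp _‖ ≤ ‖h‖ * ‖grad w‖ := by
    refine norm_toLp_le_of_forall_testFunction hD hG (by positivity) fun φ hφ => ?_
    rw [hφ.eLpNorm_restrict]
    convert abs_integral_mul_comp_sub_sub_le hbdd w hφ hseg using 2
    simp only [sub_mul]
    have hs := integral_sub (hm1.integrable_mul hφ.memLp) (hm0.integrable_mul hφ.memLp)
    simp only [Pi.mul_apply] at hs
    rw [hs]
    congr 1
    · rw [setIntegral_eq_integral_of_forall_compl_eq_zero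
          (fun x hx => by simp [hφ.eq_zero_of_notMem hx]),
        setIntegral_eq_integral_of_forall_compl_eq_zero (s := Ω)]
      · rw [← integral_add_right_eq_self (fun y => fn w y * φ (y - h)) h]
        simp
      · intro x hx
        rw [hφ.eq_zero_of_notMem, mul_zero]
        exact fun hx' => hx (by simpa using hDh hx')
    · rw [setIntegral_eq_integral_of_forall_compl_eq_zero
          (fun x hx => by simp [hφ.eq_zero_of_notMem hx]),
        setIntegral_eq_integral_of_forall_compl_eq_zero (s := Ω)]
      intro x hx
      rw [hφ.eq_zero_of_notMem (fun hx' => hx (hDΩ hx')), mul_zero]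
  have hle' : ‖hG.toLp _‖ₑ ≤ ‖h‖ₑ * ‖grad w‖ₑ := by
    rw [← ofReal_norm, ← ofReal_norm, ← ofReal_norm,
      ← ENNReal.ofReal_mul (norm_nonneg _)]
    exact ENNReal.ofReal_le_ofReal hle
  rw [← mul_pow]
  refine le_trans (le_of_eq ?_) (pow_le_pow_left' hle' 2)
  rw [Lp.enorm_toLp, eLpNorm_eq_lintegral_rpow_enorm_toReal (by norm_num) (by norm_num)]
  rw [← ENNReal.rpow_natCast, ← ENNReal.rpow_mul]
  simp

/-! ### Oscillation bounds -/

/-- The mean-square oscillation of `u ∈ H¹(Ω)` between `D` and `E` is controlled by the gradient on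
all of `Ω`: `∫_D ∫_E |u(x) - u(y)|² dy dx ≤ C ‖∇u‖²_{L²(Ω)}` with `C` independent of `u`. The
integrals are lower Lebesgue integrals, so that no integrability is presupposed. -/
def OscBound (Ω D E : Set (Eucl d)) : Prop :=
  ∃ C : ℝ≥0, ∀ w : H1 Ω,
    ∫⁻ x in D, ∫⁻ y in E, ‖fn w x - fn w y‖ₑ ^ 2 ≤ C * ‖grad w‖ₑ ^ 2

lemma measurable_fn (w : H1 Ω) : Measurable (fn w) := (Lp.stronglyMeasurable (fn w)).measurable

lemma enorm_sq_eq_ofReal (a : ℝ) : ‖a‖ₑ ^ 2 = ENNReal.ofReal (a ^ 2) := by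
  rw [Real.enorm_eq_ofReal_abs, ← ENNReal.ofReal_pow (abs_nonneg _), sq_abs]

lemma enorm_sub_sq_le (a b c : ℝ) : ‖a - c‖ₑ ^ 2 ≤ 2 * ‖a - b‖ₑ ^ 2 + 2 * ‖b - c‖ₑ ^ 2 := by
  have h2 : (2 : ℝ≥0∞) = ENNReal.ofReal 2 := by simp
  rw [enorm_sq_eq_ofReal, enorm_sq_eq_ofReal, enorm_sq_eq_ofReal, h2,
    ← ENNReal.ofReal_mul zero_le_two, ← ENNReal.ofReal_mul zero_le_two,
    ← ENNReal.ofReal_add (by positivity) (by positivity)]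
  exact ENNReal.ofReal_le_ofReal (by nlinarith [sq_nonneg (a - b - (b - c))])

lemma OscBound.mono {D' E' : Set (Eucl d)} (h : OscBound Ω D E) (hD : D' ⊆ D) (hE : E' ⊆ E) :
    OscBound Ω D' E' := by
  obtain ⟨C, hC⟩ := h
  exact ⟨C, fun w => (lintegral_mono' (Measure.restrict_mono hD le_rfl)
    fun x => lintegral_mono_set hE).trans (hC w)⟩

lemma OscBound.symm (h : OscBound Ω D E) : OscBound Ω E D := by
  obtain ⟨C, hC⟩ := h
  refine ⟨C, fun w => le_trans (le_of_eq ?_) (hC w)⟩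
  have hm := measurable_fn w
  rw [lintegral_lintegral_swap (by fun_prop)]
  simp only [enorm_sub_rev]

lemma OscBound.empty : OscBound Ω ∅ E := ⟨0, fun w => by simp⟩

lemma OscBound.union (h : OscBound Ω D E) (h' : OscBound Ω F E) : OscBound Ω (D ∪ F) E := by
  obtain ⟨C, hC⟩ := h
  obtain ⟨C', hC'⟩ := h'
  refine ⟨C + C', fun w => (lintegral_union_le _ _ _).trans ?_⟩
  rw [ENNReal.coe_add, add_mul]
  exact add_le_add (hC w) (hC' w)

/-- Averaging `|u(x) - u(z)|² ≤ 2 |u(x) - u(y)|² + 2 |u(y) - u(z)|²` over `y ∈ E`. -/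
lemma OscBound.trans (hDE : OscBound Ω D E) (hEF : OscBound Ω E F) (hE0 : volume E ≠ 0)
    (hE : volume E ≠ ⊤) (hD : volume D ≠ ⊤) (hF : volume F ≠ ⊤) : OscBound Ω D F := by
  obtain ⟨C, hC⟩ := hDE.symm
  obtain ⟨C', hC'⟩ := hEF
  lift volume E to ℝ≥0 using hE with e he
  lift volume D to ℝ≥0 using hD with a ha
  lift volume F to ℝ≥0 using hF with b hb
  have he0 : e ≠ 0 := by simpa using hE0
  refine ⟨e⁻¹ * (2 * b * C + 2 * a * C'), fun w => ?_⟩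
  have hm := measurable_fn w
  set I := ∫⁻ x in D, ∫⁻ z in F, ‖fn w x - fn w z‖ₑ ^ 2 with hI
  have h1 : ∀ y, I ≤ 2 * b * (∫⁻ x in D, ‖fn w y - fn w x‖ₑ ^ 2) +
      2 * a * ∫⁻ z in F, ‖fn w y - fn w z‖ₑ ^ 2 := by
    intro y
    calc I ≤ ∫⁻ x in D, ∫⁻ z in F,
          (2 * ‖fn w y - fn w x‖ₑ ^ 2 + 2 * ‖fn w y - fn w z‖ₑ ^ 2) := by
          refine lintegral_mono fun x => lintegral_mono fun z => ?_
          rw [enorm_sub_rev (fn w y) (fn w x)]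
          exact enorm_sub_sq_le _ _ _
      _ = ∫⁻ x in D, (2 * b * ‖fn w y - fn w x‖ₑ ^ 2 +
          2 * ∫⁻ z in F, ‖fn w y - fn w z‖ₑ ^ 2) := by
          refine lintegral_congr fun x => ?_
          rw [lintegral_add_left (by fun_prop), lintegral_const, Measure.restrict_apply_univ, ← hb,
            lintegral_const_mul _ (by fun_prop)]
          ring
      _ = _ := by
          rw [lintegral_add_left (by fun_prop), lintegral_const, Measure.restrict_apply_univ, ← ha,
            lintegral_const_mul _ (by fun_prop)]
          ring
  have h2 : e * I ≤ (2 * b * C + 2 * a * C') * ‖grad w‖ₑ ^ 2 := by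
    calc (e : ℝ≥0∞) * I = ∫⁻ y in E, I := by
          rw [lintegral_const, Measure.restrict_apply_univ, ← he, mul_comm]
      _ ≤ ∫⁻ y in E, (2 * b * (∫⁻ x in D, ‖fn w y - fn w x‖ₑ ^ 2) +
          2 * a * ∫⁻ z in F, ‖fn w y - fn w z‖ₑ ^ 2) := lintegral_mono h1
      _ = 2 * b * (∫⁻ y in E, ∫⁻ x in D, ‖fn w y - fn w x‖ₑ ^ 2) +
          2 * a * ∫⁻ y in E, ∫⁻ z in F, ‖fn w y - fn w z‖ₑ ^ 2 := by
          have hmD : Measurable fun y => ∫⁻ x in D, ‖fn w y - fn w x‖ₑ ^ 2 :=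
            Measurable.lintegral_prod_right' (f := fun p : Eucl d × Eucl d =>
              ‖fn w p.1 - fn w p.2‖ₑ ^ 2) (by fun_prop)
          have hmF : Measurable fun y => ∫⁻ x in F, ‖fn w y - fn w x‖ₑ ^ 2 :=
            Measurable.lintegral_prod_right' (f := fun p : Eucl d × Eucl d =>
              ‖fn w p.1 - fn w p.2‖ₑ ^ 2) (by fun_prop)
          rw [lintegral_add_left (by fun_prop), lintegral_const_mul _ hmD,
            lintegral_const_mul _ hmF]
      _ ≤ 2 * b * (C * ‖grad w‖ₑ ^ 2) + 2 * a * (C' * ‖grad w‖ₑ ^ 2) := by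
          gcongr
          · exact hC w
          · exact hC' w
      _ = _ := by ring
  have h3 : I = (e : ℝ≥0∞)⁻¹ * (e * I) := by
    rw [← mul_assoc, ENNReal.inv_mul_cancel (by simpa using he0) (by simp), one_mul]
  rw [h3]
  push_cast [ENNReal.coe_inv he0]
  rw [mul_assoc]
  gcongr

/-- Chaining through a common nonempty open subset of `E` and `E'`. -/
lemma OscBound.trans_of_subset {E' O : Set (Eucl d)} (h : OscBound Ω D E) (h' : OscBound Ω E' F)
    (hO : IsOpen O) (hne : O.Nonempty) (hOE : O ⊆ E) (hOE' : O ⊆ E') (hE : Bornology.IsBounded E)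
    (hD : Bornology.IsBounded D) (hF : Bornology.IsBounded F) : OscBound Ω D F :=
  (h.mono subset_rfl hOE).trans (h'.mono hOE' subset_rfl) (hO.measure_pos volume hne).ne'
    (hE.subset hOE).measure_lt_top.ne hD.measure_lt_top.ne hF.measure_lt_top.ne

/-- Poincaré inequality on a ball: substitute `y = x + h` and use the translation estimate on
`{x | x, x + h ∈ ball c r}`, from which all segments `[x, x + h]` stay in the ball. -/
lemma oscBound_ball (hΩ : IsOpen Ω) (hbdd : Bornology.IsBounded Ω) {c : Eucl d} {r : ℝ}
    (hK : Metric.ball c r ⊆ Ω) : OscBound Ω (Metric.ball c r) (Metric.ball c r) := by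
  set K := Metric.ball c r with hKdef
  set R : ℝ≥0 := Real.toNNReal (2 * r)
  set H : Set (Eucl d) := Metric.ball 0 (2 * r)
  refine ⟨R ^ 2 * (volume H).toNNReal, fun w => ?_⟩
  have hm := measurable_fn w
  have hKm : MeasurableSet K := measurableSet_ball
  have e1 : ∀ x, ∫⁻ y in K, ‖fn w x - fn w y‖ₑ ^ 2 =
      ∫⁻ h, K.indicator (fun y => ‖fn w x - fn w y‖ₑ ^ 2) (x + h) := fun x => by
    rw [lintegral_add_left_eq_self (K.indicator fun y => ‖fn w x - fn w y‖ₑ ^ 2) x,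
      lintegral_indicator hKm]
  simp only [e1]
  rw [lintegral_lintegral_swap]
  · have hle : ∀ h, ∫⁻ x in K, K.indicator (fun y => ‖fn w x - fn w y‖ₑ ^ 2) (x + h) ≤
        H.indicator (fun _ => (R : ℝ≥0∞) ^ 2 * ‖grad w‖ₑ ^ 2) h := by
      intro h
      by_cases hh : h ∈ H
      · rw [indicator_of_mem hh]
        have hS : IsOpen ((fun x => x + h) ⁻¹' K) :=
          Metric.isOpen_ball.preimage (continuous_id.add continuous_const)
        have e2 : ∫⁻ x in K, K.indicator (fun y => ‖fn w x - fn w y‖ₑ ^ 2) (x + h) =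
            ∫⁻ x in (fun x => x + h) ⁻¹' K ∩ K, ‖fn w (x + h) - fn w x‖ₑ ^ 2 := by
          rw [← Measure.restrict_restrict hS.measurableSet, ← lintegral_indicator hS.measurableSet]
          refine lintegral_congr fun x => ?_
          by_cases hx : x + h ∈ K
          · rw [indicator_of_mem hx, indicator_of_mem (by exact hx), enorm_sub_rev]
          · rw [indicator_of_notMem hx, indicator_of_notMem (by exact hx)]
        rw [e2]
        refine (lintegral_translate_sub_le hΩ.measurableSet hbdd (hS.inter Metric.isOpen_ball)
          (fun x hx t ht => hK ?_) w).trans ?_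
        · simpa only [add_sub_cancel_left] using
            (convex_ball c r).add_smul_sub_mem hx.2 hx.1 ht
        · gcongr
          rw [← ofReal_norm]
          exact ENNReal.ofReal_le_ofReal (by simpa [H] using (mem_ball_zero_iff.1 hh).le)
      · rw [indicator_of_notMem hh]
        refine le_of_eq (setLIntegral_eq_zero hKm fun x hx => ?_)
        refine indicator_of_notMem (fun hx' => hh ?_) _
        have h1 := Metric.mem_ball.1 hx
        have h2 := Metric.mem_ball.1 hx'
        rw [mem_ball_zero_iff]
        calc ‖h‖ = dist (x + h) x := by simp [dist_eq_norm]
          _ ≤ dist (x + h) c + dist x c := dist_triangle_right _ _ _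
          _ < 2 * r := by linarith
    refine (lintegral_mono hle).trans (le_of_eq ?_)
    rw [lintegral_indicator measurableSet_ball, lintegral_const, Measure.restrict_apply_univ]
    push_cast
    rw [ENNReal.coe_toNNReal Metric.isBounded_ball.measure_lt_top.ne]
    ring
  · have : Measurable (((fun p : Eucl d × Eucl d => p.1 + p.2) ⁻¹' K).indicator
        fun p : Eucl d × Eucl d => ‖fn w p.1 - fn w (p.1 + p.2)‖ₑ ^ 2) :=
      Measurable.indicator (by fun_prop) ((measurable_fst.add measurable_snd) hKm)
    exact this.aemeasurable

/-- If translation by `h` sweeps `D` through `Ω` into `K`, then an oscillation bound on `K` transfers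
to one between `D` and `K`. -/
lemma OscBound.of_translate (hΩ : IsOpen Ω) (hbdd : Bornology.IsBounded Ω) {K : Set (Eucl d)}
    (hK : OscBound Ω K K) (hKb : Bornology.IsBounded K) (hKm : MeasurableSet K)
    (hD : IsOpen D) {h : Eucl d}
    (hseg : ∀ x ∈ D, ∀ t ∈ Icc (0 : ℝ) 1, x + t • h ∈ Ω) (hDK : ∀ x ∈ D, x + h ∈ K) :
    OscBound Ω D K := by
  obtain ⟨C, hC⟩ := hK
  have hKf : volume K ≠ ⊤ := hKb.measure_lt_top.ne
  lift volume K to ℝ≥0 using hKf with k hk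
  refine ⟨2 * k * ‖h‖₊ ^ 2 + 2 * C, fun w => ?_⟩
  have hm := measurable_fn w
  have hmK : Measurable fun x => ∫⁻ y in K, ‖fn w x - fn w y‖ₑ ^ 2 :=
    Measurable.lintegral_prod_right' (f := fun p : Eucl d × Eucl d =>
      ‖fn w p.1 - fn w p.2‖ₑ ^ 2) (by fun_prop)
  have hmKh : Measurable fun x => ∫⁻ y in K, ‖fn w (x + h) - fn w y‖ₑ ^ 2 :=
    hmK.comp (measurable_add_const h)
  have hmap : MeasurePreserving (fun x => x + h) (volume.restrict ((fun x => x + h) ⁻¹' K))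
      (volume.restrict K) :=
    (measurePreserving_add_right (volume : Measure (Eucl d)) h).restrict_preimage hKm
  calc ∫⁻ x in D, ∫⁻ y in K, ‖fn w x - fn w y‖ₑ ^ 2
      ≤ ∫⁻ x in D, ∫⁻ y in K,
          (2 * ‖fn w (x + h) - fn w x‖ₑ ^ 2 + 2 * ‖fn w (x + h) - fn w y‖ₑ ^ 2) := by
        refine lintegral_mono fun x => lintegral_mono fun y => ?_
        rw [enorm_sub_rev (fn w (x + h)) (fn w x)]
        exact enorm_sub_sq_le _ _ _
    _ = ∫⁻ x in D, (2 * k * ‖fn w (x + h) - fn w x‖ₑ ^ 2 +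
          2 * ∫⁻ y in K, ‖fn w (x + h) - fn w y‖ₑ ^ 2) := by
        refine lintegral_congr fun x => ?_
        rw [lintegral_add_left (by fun_prop), lintegral_const, Measure.restrict_apply_univ, ← hk,
          lintegral_const_mul _ (by fun_prop)]
        ring
    _ = 2 * k * (∫⁻ x in D, ‖fn w (x + h) - fn w x‖ₑ ^ 2) +
          2 * ∫⁻ x in D, ∫⁻ y in K, ‖fn w (x + h) - fn w y‖ₑ ^ 2 := by
        rw [lintegral_add_left (by fun_prop), lintegral_const_mul _ (by fun_prop),
          lintegral_const_mul _ hmKh]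
    _ ≤ 2 * k * (‖h‖ₑ ^ 2 * ‖grad w‖ₑ ^ 2) + 2 * (C * ‖grad w‖ₑ ^ 2) := by
        gcongr
        · exact lintegral_translate_sub_le hΩ.measurableSet hbdd hD hseg w
        · refine le_trans ?_ (hC w)
          rw [← hmap.lintegral_comp hmK]
          exact lintegral_mono_set hDK
    _ = _ := by
        push_cast
        rw [← enorm_eq_nnnorm]
        ring

/-! ### From local bounds to a Lipschitz domain -/

/-- Near a boundary point, moving in the direction of the graph's axis carries `Ω` into a ball
contained in `Ω`. The shift `M r` with `M = 2 K + 2` is large enough to lift the whole ball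
`ball p r` above the graph of a `K`-Lipschitz function through `p`. -/
lemma exists_oscBound_of_mem_frontier (hΩ : IsOpen Ω) (hbdd : Bornology.IsBounded Ω)
    (hlip : HasLipschitzBoundary Ω) {p : Eucl d} (hp : p ∈ frontier Ω) :
    ∃ r > 0, ∃ q, Metric.ball q r ⊆ Ω ∧ OscBound Ω (Metric.ball p r ∩ Ω) (Metric.ball q r) := by
  obtain ⟨e, φ, K, U, he, hφ, hU, hpU, hiff⟩ := hlip p hp
  obtain ⟨R, hR, hRU⟩ := Metric.isOpen_iff.1 hU p hpU
  set M : ℝ := 2 * K + 2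
  have hM : 2 ≤ M := by simp [M]
  set r : ℝ := R / (M + 1)
  have hr : 0 < r := by positivity
  have hrR : r + M * r = R := by simp only [r]; field_simp; ring
  have hee : ⟪e, e⟫ = 1 := by rw [real_inner_self_eq_norm_sq, he, one_pow]
  -- the base point is unchanged by moving along `e`, while the height grows
  have hproj : ∀ (x : Eucl d) (s : ℝ), (x + s • e) - ⟪e, x + s • e⟫ • e = x - ⟪e, x⟫ • e := by
    intro x s
    rw [inner_add_right, inner_smul_right, hee]
    module
  have hheight : ∀ (x : Eucl d) (s : ℝ), ⟪e, x + s • e⟫ = ⟪e, x⟫ + s := by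
    intro x s
    rw [inner_add_right, inner_smul_right, hee, mul_one]
  have hmemU : ∀ x ∈ Metric.ball p r, ∀ s : ℝ, 0 ≤ s → s ≤ M * r → x + s • e ∈ U := by
    intro x hx s hs0 hs
    refine hRU ?_
    rw [Metric.mem_ball] at hx ⊢
    calc dist (x + s • e) p ≤ dist (x + s • e) x + dist x p := dist_triangle _ _ _
      _ = s + dist x p := by simp [dist_eq_norm, norm_smul, he, abs_of_nonneg hs0]
      _ < R := by linarith
  have hp_le : φ (p - ⟪e, p⟫ • e) ≤ ⟪e, p⟫ := by
    have hcl : p ∈ closure (Ω ∩ U) := hU.closure_inter ⟨frontier_subset_closure hp, hpU⟩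
    refine closure_minimal (t := {x | φ (x - ⟪e, x⟫ • e) ≤ ⟪e, x⟫}) ?_ ?_ hcl
    · exact fun x hx => ((hiff x hx.2).1 hx.1).le
    · have := hφ.continuous
      exact isClosed_le (by fun_prop) (by fun_prop)
  have hup : ∀ x ∈ Metric.ball p r, φ (x - ⟪e, x⟫ • e) < ⟪e, x⟫ + M * r := by
    intro x hx
    have hxp : ‖x - p‖ < r := by rwa [Metric.mem_ball, dist_eq_norm] at hx
    have hin : |⟪e, x - p⟫| ≤ ‖x - p‖ := by
      simpa [he] using abs_real_inner_le_norm e (x - p)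
    have hd : dist (x - ⟪e, x⟫ • e) (p - ⟪e, p⟫ • e) ≤ 2 * r := by
      rw [dist_eq_norm]
      have : x - ⟪e, x⟫ • e - (p - ⟪e, p⟫ • e) = (x - p) - ⟪e, x - p⟫ • e := by
        rw [inner_sub_right]; module
      rw [this]
      refine (norm_sub_le _ _).trans ?_
      rw [norm_smul, he, mul_one, Real.norm_eq_abs]
      linarith
    have hφd : φ (x - ⟪e, x⟫ • e) - φ (p - ⟪e, p⟫ • e) ≤ K * (2 * r) := by
      refine (le_abs_self _).trans ?_
      rw [← Real.dist_eq]
      exact (hφ.dist_le_mul _ _).trans (by gcongr)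
    rw [inner_sub_right] at hin
    have := (abs_le.1 hin).1
    have hMr : M * r = K * (2 * r) + 2 * r := by simp only [M]; ring
    linarith
  have hMr0 : 0 ≤ M * r := by positivity
  have hball : Metric.ball (p + (M * r) • e) r ⊆ Ω := by
    intro y hy
    have hx : y - (M * r) • e ∈ Metric.ball p r := by
      rw [Metric.mem_ball, dist_eq_norm] at hy ⊢
      convert hy using 2
      abel
    have h1 := hup _ hx
    have h2 := hmemU _ hx (M * r) hMr0 le_rfl
    have h3 := (hiff _ h2).2
    rw [hproj, hheight] at h3
    simpa using h3 h1
  refine ⟨r, hr, p + (M * r) • e, hball, ?_⟩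
  refine (oscBound_ball hΩ hbdd hball).of_translate hΩ hbdd Metric.isBounded_ball
    measurableSet_ball (Metric.isOpen_ball.inter hΩ) (h := (M * r) • e) ?_ ?_
  · rintro x ⟨hx, hxΩ⟩ t ht
    rw [smul_smul]
    have hxU : x ∈ U := by simpa using hmemU x hx 0 le_rfl hMr0
    have hs0 : 0 ≤ t * (M * r) := mul_nonneg ht.1 hMr0
    refine (hiff _ (hmemU x hx _ hs0 (mul_le_of_le_one_left hMr0 ht.2))).2 ?_
    rw [hproj, hheight]
    have := (hiff x hxU).1 hxΩ
    linarith
  · rintro x ⟨hx, -⟩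
    rw [Metric.mem_ball] at hx ⊢
    simpa using hx

/-- By connectedness, every point of `Ω` has a neighbourhood joined to a fixed ball by an
oscillation bound. -/
lemma exists_ball_oscBound (hΩ : IsOpen Ω) (hbdd : Bornology.IsBounded Ω)
    (hconn : IsPreconnected Ω) {x₀ : Eucl d} {r₀ : ℝ} (hr₀ : 0 < r₀)
    (hball : Metric.ball x₀ r₀ ⊆ Ω) {x : Eucl d} (hx : x ∈ Ω) :
    ∃ r > 0, OscBound Ω (Metric.ball x r) (Metric.ball x₀ r₀) := by
  set S : Set (Eucl d) := {x | ∃ r > 0, OscBound Ω (Metric.ball x r) (Metric.ball x₀ r₀)}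
  have hS : IsOpen S := by
    refine Metric.isOpen_iff.2 ?_
    rintro y ⟨r, hr, h⟩
    refine ⟨r, hr, fun z hz => ?_⟩
    obtain ⟨ε, hε, hsub⟩ := Metric.isOpen_iff.1 Metric.isOpen_ball z hz
    exact ⟨ε, hε, h.mono hsub subset_rfl⟩
  refine hconn.subset_of_closure_inter_subset hS
    ⟨x₀, hball (Metric.mem_ball_self hr₀), r₀, hr₀, oscBound_ball hΩ hbdd hball⟩ ?_ hx
  rintro y ⟨hyS, hyΩ⟩
  obtain ⟨r, hr, hrΩ⟩ := Metric.isOpen_iff.1 hΩ y hyΩ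
  obtain ⟨z, ⟨s, hs, hzs⟩, hyz⟩ := Metric.mem_closure_iff.1 hyS r hr
  refine ⟨r, hr, (oscBound_ball hΩ hbdd hrΩ).trans_of_subset hzs
    (Metric.isOpen_ball.inter Metric.isOpen_ball) ⟨z, ?_, Metric.mem_ball_self hs⟩
    inter_subset_left inter_subset_right Metric.isBounded_ball Metric.isBounded_ball
    Metric.isBounded_ball⟩
  rwa [Metric.mem_ball']

/-- Poincaré inequality on a bounded Lipschitz domain, in oscillation form. The local bounds cover
the compact set `closure Ω`. -/
lemma IsBoundedLipschitzDomain.exists_ball_oscBound (hΩ : IsBoundedLipschitzDomain Ω) :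
    ∃ x₀ : Eucl d, ∃ r₀ > 0, Metric.ball x₀ r₀ ⊆ Ω ∧ OscBound Ω Ω (Metric.ball x₀ r₀) := by
  obtain ⟨x₀, hx₀⟩ := hΩ.isConnected.nonempty
  obtain ⟨r₀, hr₀, hball⟩ := Metric.isOpen_iff.1 hΩ.isOpen x₀ hx₀
  refine ⟨x₀, r₀, hr₀, hball, ?_⟩
  have hin : ∀ x ∈ Ω, ∃ r > 0, OscBound Ω (Metric.ball x r) (Metric.ball x₀ r₀) := fun x hx =>
    PDEReg.exists_ball_oscBound hΩ.isOpen hΩ.isBounded hΩ.isConnected.isPreconnected hr₀ hball hx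
  have hcpt : IsCompact (closure Ω) := hΩ.isBounded.isCompact_closure
  have key : OscBound Ω (closure Ω ∩ Ω) (Metric.ball x₀ r₀) := by
    refine hcpt.induction_on (p := fun s => OscBound Ω (s ∩ Ω) (Metric.ball x₀ r₀)) ?_ ?_ ?_ ?_
    · rw [empty_inter]; exact .empty
    · exact fun s t hst ht => ht.mono (inter_subset_inter_left _ hst) subset_rfl
    · intro s t hs ht
      rw [union_inter_distrib_right]
      exact hs.union ht
    · intro p hp
      by_cases hpΩ : p ∈ Ω
      · obtain ⟨r, hr, h⟩ := hin p hpΩ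
        exact ⟨Metric.ball p r, mem_nhdsWithin_of_mem_nhds (Metric.ball_mem_nhds p hr),
          h.mono inter_subset_left subset_rfl⟩
      · have hpf : p ∈ frontier Ω := by rw [hΩ.isOpen.frontier_eq]; exact ⟨hp, hpΩ⟩
        obtain ⟨r, hr, q, hq, h⟩ :=
          exists_oscBound_of_mem_frontier hΩ.isOpen hΩ.isBounded hΩ.lipschitz hpf
        obtain ⟨s, hs, hqs⟩ := hin q (hq (Metric.mem_ball_self hr))
        refine ⟨Metric.ball p r, mem_nhdsWithin_of_mem_nhds (Metric.ball_mem_nhds p hr), ?_⟩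
        exact h.trans_of_subset hqs (Metric.isOpen_ball.inter Metric.isOpen_ball)
          ⟨q, Metric.mem_ball_self hr, Metric.mem_ball_self hs⟩ inter_subset_left
          inter_subset_right Metric.isBounded_ball
          (Metric.isBounded_ball.subset inter_subset_left) Metric.isBounded_ball
  rwa [inter_eq_right.2 subset_closure] at key

lemma IsBoundedLipschitzDomain.oscBound (hΩ : IsBoundedLipschitzDomain Ω) : OscBound Ω Ω Ω := by
  obtain ⟨x₀, r₀, hr₀, hball, h⟩ := hΩ.exists_ball_oscBound
  exact h.trans_of_subset h.symm Metric.isOpen_ball ⟨x₀, Metric.mem_ball_self hr₀⟩ subset_rfl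
    subset_rfl Metric.isBounded_ball hΩ.isBounded hΩ.isBounded

/-! ### Poincaré inequality -/

/-- The mean is the closest constant in mean square, whence `|B| (s - ⨍_B u)² ≤ ∫_B (s - u)²`. -/
lemma measureReal_mul_sub_average_sq_le {X : Type*} [MeasurableSpace X] {μ : Measure X}
    [IsFiniteMeasure μ] [NeZero μ] {u : X → ℝ} (hu : MemLp u 2 μ) (s : ℝ) :
    μ.real univ * (s - ⨍ x, u x ∂μ) ^ 2 ≤ ∫ x, (s - u x) ^ 2 ∂μ := by
  set c := ⨍ x, u x ∂μ with hc
  have hu1 : Integrable u μ := hu.integrable (by norm_num)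
  have hmean : μ.real univ * c = ∫ x, u x ∂μ := by
    rw [hc, ← smul_eq_mul, measure_smul_average]
  have h1 : Integrable (fun x => (s - c) ^ 2 + 2 * (s - c) * (c - u x)) μ :=
    (integrable_const _).add (((integrable_const _).sub hu1).const_mul _)
  have h2 : Integrable (fun x => (s - u x) ^ 2) μ := ((memLp_const s).sub hu).integrable_sq
  calc μ.real univ * (s - c) ^ 2 = ∫ x, ((s - c) ^ 2 + 2 * (s - c) * (c - u x)) ∂μ := by
        have h3 : Integrable (fun x => c - u x) μ := (integrable_const c).sub hu1
        rw [integral_add (integrable_const _) (h3.const_mul _),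
          integral_const_mul, integral_sub (integrable_const _) hu1, integral_const,
          integral_const, ← hmean]
        simp
    _ ≤ ∫ x, (s - u x) ^ 2 ∂μ := by
        refine integral_mono h1 h2 fun x => ?_
        nlinarith [sq_nonneg (c - u x)]

/-- Poincaré inequality with the mean over a nonempty open subset in place of the mean over `Ω`. -/
theorem IsBoundedLipschitzDomain.exists_norm_fn_sq_le (hΩ : IsBoundedLipschitzDomain Ω)
    {B : Set (Eucl d)} (hB : IsOpen B) (hBne : B.Nonempty) (hBΩ : B ⊆ Ω) :
    ∃ C : ℝ, 0 ≤ C ∧ ∀ w : H1 Ω,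
      ‖fn w‖ ^ 2 ≤ C * (‖grad w‖ ^ 2 + (⨍ x in B, fn w x) ^ 2) := by
  obtain ⟨C, hC⟩ := hΩ.oscBound.mono subset_rfl hBΩ
  have hBpos : 0 < volume B := hB.measure_pos volume hBne
  have hBfin : volume B ≠ ⊤ := (hΩ.isBounded.subset hBΩ).measure_lt_top.ne
  have hΩfin : volume Ω ≠ ⊤ := hΩ.isBounded.measure_lt_top.ne
  have : IsFiniteMeasure (volume.restrict B) := ⟨by
    rw [Measure.restrict_apply_univ]; exact hBfin.lt_top⟩
  have : NeZero (volume.restrict B) := ⟨by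
    rw [Ne, Measure.restrict_eq_zero]; exact hBpos.ne'⟩
  have hbr : 0 < volume.real B := ENNReal.toReal_pos hBpos.ne' hBfin
  set b := volume.real B with hb
  refine ⟨2 * (b⁻¹ * C) + 2 * volume.real Ω, by positivity, fun w => ?_⟩
  have hm := measurable_fn w
  set c := ⨍ x in B, fn w x with hc
  have hmB : MemLp (fn w) 2 (volume.restrict B) :=
    (Lp.memLp (fn w)).mono_measure (Measure.restrict_mono hBΩ le_rfl)
  have h1 : ∀ x, ENNReal.ofReal b * ‖fn w x - c‖ₑ ^ 2 ≤
      ∫⁻ y in B, ‖fn w x - fn w y‖ₑ ^ 2 := by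
    intro x
    simp only [enorm_sq_eq_ofReal]
    have hint : Integrable (fun y => (fn w x - fn w y) ^ 2) (volume.restrict B) :=
      ((memLp_const (fn w x)).sub hmB).integrable_sq
    rw [← ENNReal.ofReal_mul hbr.le, ← ofReal_integral_eq_lintegral_ofReal hint
      (Eventually.of_forall fun y => sq_nonneg _)]
    refine ENNReal.ofReal_le_ofReal ?_
    simpa [hb, hc, measureReal_def] using measureReal_mul_sub_average_sq_le hmB (fn w x)
  have h2 : ENNReal.ofReal b * ∫⁻ x in Ω, ‖fn w x - c‖ₑ ^ 2 ≤ C * ‖grad w‖ₑ ^ 2 := by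
    rw [← lintegral_const_mul _ (by fun_prop)]
    exact (lintegral_mono h1).trans (hC w)
  have hmΩ : MemLp (fun x => fn w x - c) 2 (volume.restrict Ω) := by
    have : IsFiniteMeasure (volume.restrict Ω) := ⟨by
      rw [Measure.restrict_apply_univ]; exact hΩfin.lt_top⟩
    exact (Lp.memLp (fn w)).sub (memLp_const c)
  have hintc := hmΩ.integrable_sq
  have h3 : b * ∫ x in Ω, (fn w x - c) ^ 2 ≤ C * ‖grad w‖ ^ 2 := by
    simp only [enorm_sq_eq_ofReal] at h2
    rw [← ofReal_integral_eq_lintegral_ofReal hintc (Eventually.of_forall fun y => sq_nonneg _),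
      ← ENNReal.ofReal_mul hbr.le, ← ofReal_norm, ← ENNReal.ofReal_pow (norm_nonneg _),
      ← ENNReal.ofReal_coe_nnreal, ← ENNReal.ofReal_mul C.coe_nonneg] at h2
    exact (ENNReal.ofReal_le_ofReal_iff (by positivity)).1 h2
  have h4 : ‖fn w‖ ^ 2 = ∫ x in Ω, fn w x ^ 2 := by
    rw [← real_inner_self_eq_norm_sq, L2.inner_def]
    refine integral_congr_ae (Eventually.of_forall fun x => ?_)
    simp [sq]
  have : IsFiniteMeasure (volume.restrict Ω) := ⟨by
    rw [Measure.restrict_apply_univ]; exact hΩfin.lt_top⟩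
  have h5 : ∫ x in Ω, fn w x ^ 2 ≤ ∫ x in Ω, (2 * (fn w x - c) ^ 2 + 2 * c ^ 2) := by
    refine integral_mono (Lp.memLp (fn w)).integrable_sq
      ((hintc.const_mul 2).add (integrable_const _)) fun x => ?_
    nlinarith [sq_nonneg (fn w x - 2 * c)]
  rw [integral_add (hintc.const_mul 2) (integrable_const _), integral_const_mul, integral_const]
    at h5
  have h6 : ∫ x in Ω, (fn w x - c) ^ 2 ≤ b⁻¹ * C * ‖grad w‖ ^ 2 := by
    rw [mul_assoc, le_inv_mul_iff₀ hbr]; exact h3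
  simp only [measureReal_restrict_apply_univ, smul_eq_mul] at h5
  rw [h4]
  have h7 : 0 ≤ volume.real Ω * ‖grad w‖ ^ 2 := by positivity
  have h8 : 0 ≤ b⁻¹ * C * c ^ 2 := by positivity
  nlinarith

/-! ### Coercive quadratic minimization in a Hilbert space -/

section Abstract

variable {X : Type*} [NormedAddCommGroup X] [InnerProductSpace ℝ X]
  {c : X →L[ℝ] X →L[ℝ] ℝ} {V : Submodule ℝ X} {κ : ℝ}

/-- A nonnegative symmetric quadratic functional is minimal exactly where its first variation
vanishes: `J(u + t v) - J(u) = t (c(u,v) - r(v)) + t² c(v,v) / 2`. -/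
lemma forall_energy_le_iff (hsymm : ∀ u v, c u v = c v u) (hnn : ∀ v, 0 ≤ c v v) (r : X →L[ℝ] ℝ)
    {u : X} (hu : u ∈ V) :
    (∀ v ∈ V, 1 / 2 * c u u - r u ≤ 1 / 2 * c v v - r v) ↔ ∀ v ∈ V, c u v = r v := by
  constructor
  · intro h v hv
    have hq : ∀ t : ℝ, 0 ≤ (1 / 2 * c v v) * (t * t) + (c u v - r v) * t + 0 := by
      intro t
      have h1 := h (u + t • v) (V.add_mem hu (V.smul_mem t hv))
      simp only [map_add, map_smul, add_apply,
        smul_apply, smul_eq_mul, hsymm v u] at h1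
      linarith
    have h2 := discrim_le_zero hq
    rw [discrim] at h2
    have h3 : (c u v - r v) ^ 2 = 0 := le_antisymm (by linarith) (sq_nonneg _)
    exact sub_eq_zero.1 (pow_eq_zero_iff two_ne_zero |>.1 h3)
  · intro h v hv
    have h1 := hnn (v - u)
    have h2 := h u hu
    have h3 := h v hv
    simp only [map_sub, sub_apply, hsymm v u] at h1
    linarith

lemma exists_mem_forall_eq [CompleteSpace X] (hV : IsClosed (V : Set X)) (hκ : 0 < κ)
    (hc : ∀ v, κ * ‖v‖ ^ 2 ≤ c v v) (r : X →L[ℝ] ℝ) : ∃ u ∈ V, ∀ v ∈ V, c u v = r v := by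
  have : CompleteSpace V := hV.completeSpace_coe
  have hco : IsCoercive (c.bilinearComp V.subtypeL V.subtypeL) := by
    refine ⟨κ, hκ, fun v => ?_⟩
    have := hc v
    rw [sq, ← mul_assoc] at this
    simpa using this
  set z : V := (InnerProductSpace.toDual ℝ V).symm (r.comp V.subtypeL) with hz
  refine ⟨hco.continuousLinearEquivOfBilin.symm z, Subtype.property _, fun v hv => ?_⟩
  have h1 := hco.continuousLinearEquivOfBilin_apply (hco.continuousLinearEquivOfBilin.symm z)
    ⟨v, hv⟩
  rw [ContinuousLinearEquiv.apply_symm_apply, hz, InnerProductSpace.toDual_symm_apply] at h1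
  simpa using h1.symm

/-- Stability: coercivity tested with the difference of two solutions. -/
lemma norm_sub_le_of_forall_eq (hκ : 0 < κ) (hc : ∀ v, κ * ‖v‖ ^ 2 ≤ c v v) {r r' : X →L[ℝ] ℝ}
    {u u' : X} (hu : u ∈ V) (hu' : u' ∈ V) (h : ∀ v ∈ V, c u v = r v) (h' : ∀ v ∈ V, c u' v = r' v) :
    ‖u - u'‖ ≤ κ⁻¹ * ‖r - r'‖ := by
  have hd : u - u' ∈ V := V.sub_mem hu hu'
  have h1 : κ * ‖u - u'‖ ^ 2 ≤ ‖r - r'‖ * ‖u - u'‖ := by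
    refine (hc _).trans ?_
    have e : c (u - u') (u - u') = (r - r') (u - u') := by
      rw [map_sub c, sub_apply, h _ hd, h' _ hd, sub_apply]
    rw [e]
    exact (le_abs_self _).trans ((r - r').le_opNorm _)
  rw [le_inv_mul_iff₀ hκ]
  rcases (norm_nonneg (u - u')).eq_or_lt with h0 | h0
  · rw [← h0, mul_zero]; positivity
  · refine le_of_mul_le_mul_right ?_ h0
    linarith

/-- Existence, uniqueness, the variational characterization and Lipschitz dependence on the data,
for a coercive symmetric problem whose right-hand side is affine in the data. -/
theorem quadratic_minimization_wellPosed [CompleteSpace X] {Y : Type*} [NormedAddCommGroup Y]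
    [NormedSpace ℝ Y] (hV : IsClosed (V : Set X)) (hsymm : ∀ u v, c u v = c v u) (hκ : 0 < κ)
    (hc : ∀ v, κ * ‖v‖ ^ 2 ≤ c v v) (l : X →L[ℝ] ℝ) (T : Y →L[ℝ] X →L[ℝ] ℝ)
    {IsMin : Y → X → Prop} (hmin : ∀ b u, IsMin b u ↔ u ∈ V ∧
      ∀ v ∈ V, 1 / 2 * c u u - (l + T b) u ≤ 1 / 2 * c v v - (l + T b) v) :
    (∀ b u, IsMin b u ↔ u ∈ V ∧ ∀ v ∈ V, c u v = (l + T b) v) ∧ (∀ b, ∃! u, IsMin b u) ∧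
      ∃ L : ℝ, 0 ≤ L ∧ ∀ b b' u u', IsMin b u → IsMin b' u' → ‖u - u'‖ ≤ L * ‖b - b'‖ := by
  have hnn : ∀ v, 0 ≤ c v v := fun v => le_trans (by positivity) (hc v)
  have hiff : ∀ b u, IsMin b u ↔ u ∈ V ∧ ∀ v ∈ V, c u v = (l + T b) v := fun b u =>
    (hmin b u).trans (and_congr_right fun hu => forall_energy_le_iff hsymm hnn (l + T b) hu)
  have hlip : ∀ b b' u u', IsMin b u → IsMin b' u' → ‖u - u'‖ ≤ κ⁻¹ * ‖T‖ * ‖b - b'‖ := by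
    intro b b' u u' hu hu'
    obtain ⟨huV, hus⟩ := (hiff b u).1 hu
    obtain ⟨hu'V, hu's⟩ := (hiff b' u').1 hu'
    refine (norm_sub_le_of_forall_eq hκ hc huV hu'V hus hu's).trans ?_
    rw [add_sub_add_left_eq_sub, ← map_sub, mul_assoc]
    gcongr
    exact T.le_opNorm _
  refine ⟨hiff, fun b => ?_, κ⁻¹ * ‖T‖, by positivity, hlip⟩
  obtain ⟨u, hu, hus⟩ := exists_mem_forall_eq hV hκ hc (l + T b)
  have hub := (hiff b u).2 ⟨hu, hus⟩
  refine ⟨u, hub, fun u' hu' => sub_eq_zero.1 (norm_le_zero_iff.1 ?_)⟩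
  simpa using hlip b b u' u hu' hub

lemma exists_bilin_add_comp {P Q : Type*} [NormedAddCommGroup P] [NormedSpace ℝ P]
    [NormedAddCommGroup Q] [NormedSpace ℝ Q] (A : P →L[ℝ] P →L[ℝ] ℝ) (S : Q →L[ℝ] Q →L[ℝ] ℝ)
    (g : X →L[ℝ] P) (u : X →L[ℝ] Q) :
    ∃ c : X →L[ℝ] X →L[ℝ] ℝ, ∀ w v, c w v = A (g w) (g v) + S (u w) (u v) :=
  ⟨A.bilinearComp g g + S.bilinearComp u u, fun _ _ => rfl⟩

end Abstract

section Concrete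

/-! ### Completeness of `H¹(Ω)` and the forms as continuous linear maps -/

variable {m : ℕ}

/-- The weak-gradient identities are closed conditions in `L²`. -/
lemma isClosed_H1 : IsClosed (H1 Ω : Set (L2Pair Ω)) := by
  have hm : ∀ {φ : Eucl d → ℝ} (_ : IsTestFunction Ω φ) (i : Fin d),
      MemLp (fun x => φ x • EuclideanSpace.single i (1 : ℝ)) 2 (volume.restrict Ω) :=
    fun hφ i => (ContinuousLinearMap.toSpanSingleton ℝ
      (EuclideanSpace.single i (1 : ℝ))).comp_memLp' hφ.memLp
  have e : (H1 Ω : Set (L2Pair Ω)) = ⋂ (φ : Eucl d → ℝ) (hφ : IsTestFunction Ω φ) (i : Fin d),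
      {p : L2Pair Ω | ⟪(hφ.memLp_fderiv (EuclideanSpace.single i 1)).toLp _, p.fst⟫ =
        -⟪(hm hφ i).toLp _, p.snd⟫} := by
    ext p
    simp only [mem_iInter, mem_ofPred_eq]
    refine forall₃_congr fun φ hφ i => ?_
    have e1 : ⟪(hφ.memLp_fderiv (EuclideanSpace.single i 1)).toLp _, p.fst⟫ =
        ∫ x in Ω, p.fst x * fderiv ℝ φ x (EuclideanSpace.single i 1) := by
      rw [L2.inner_def]
      refine integral_congr_ae ?_
      filter_upwards [(hφ.memLp_fderiv (EuclideanSpace.single i 1)).coeFn_toLp] with x hx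
      rw [hx]
      simp
    have e2 : ⟪(hm hφ i).toLp _, p.snd⟫ = ∫ x in Ω, p.snd x i * φ x := by
      rw [L2.inner_def]
      refine integral_congr_ae ?_
      filter_upwards [(hm hφ i).coeFn_toLp] with x hx
      rw [hx, real_inner_smul_left, EuclideanSpace.inner_single_left]
      simp [mul_comm]
    rw [e1, e2]
  rw [e]
  refine isClosed_iInter fun φ => isClosed_iInter fun hφ => isClosed_iInter fun i => ?_
  have h1 : Continuous fun p : L2Pair Ω => p.fst := (WithLp.fstL 2 ℝ _ _).continuous
  have h2 : Continuous fun p : L2Pair Ω => p.snd := (WithLp.sndL 2 ℝ _ _).continuous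
  exact isClosed_eq (continuous_const.inner h1) (continuous_const.inner h2).neg

instance : CompleteSpace (H1 Ω) := isClosed_H1.completeSpace_coe

/-- `fn` as a continuous linear map. -/
def fnL (Ω : Set (Eucl d)) : H1 Ω →L[ℝ] Lp ℝ 2 (volume.restrict Ω) :=
  (WithLp.fstL 2 ℝ _ _).comp (H1 Ω).subtypeL

/-- `grad` as a continuous linear map. -/
def gradL (Ω : Set (Eucl d)) : H1 Ω →L[ℝ] Lp (Eucl d) 2 (volume.restrict Ω) :=
  (WithLp.sndL 2 ℝ _ _).comp (H1 Ω).subtypeL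

lemma norm_sq_eq_fn_grad (w : H1 Ω) : ‖w‖ ^ 2 = ‖fn w‖ ^ 2 + ‖grad w‖ ^ 2 :=
  WithLp.prod_norm_sq_eq_of_L2 (w : L2Pair Ω)

/-- Multiplication by a bounded coefficient is a bounded bilinear form on `L²`. -/
lemma exists_bilin_eq_integral_mul_inner {X Y : Type*} [MeasurableSpace X] {μ : Measure X}
    [NormedAddCommGroup Y] [InnerProductSpace ℝ Y] {a : X → ℝ} (ha : MemLp a ⊤ μ) :
    ∃ A : Lp Y 2 μ →L[ℝ] Lp Y 2 μ →L[ℝ] ℝ, ∀ f g,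
      Integrable (fun x => a x * ⟪f x, g x⟫) μ ∧ A f g = ∫ x, a x * ⟪f x, g x⟫ ∂μ := by
  set T : Lp Y 2 μ →L[ℝ] Lp Y 2 μ :=
    (ContinuousLinearMap.lsmul ℝ ℝ).holderL μ ⊤ 2 2 (ha.toLp a)
  have e : ∀ f g : Lp Y 2 μ, (fun x => ⟪T f x, g x⟫) =ᵐ[μ] fun x => a x * ⟪f x, g x⟫ := by
    intro f g
    filter_upwards [ContinuousLinearMap.coeFn_holder (r := 2) (ContinuousLinearMap.lsmul ℝ ℝ)
      (ha.toLp a) f, ha.coeFn_toLp] with x h1 h2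
    have h3 : T f x = a x • f x := by
      rw [← h2]; exact h1
    rw [h3, real_inner_smul_left]
  refine ⟨ContinuousLinearMap.bilinearComp (innerSL ℝ : Lp Y 2 μ →L[ℝ] Lp Y 2 μ →L[ℝ] ℝ) T
    (ContinuousLinearMap.id ℝ _), fun f g => ⟨(L2.integrable_inner (T f) g).congr (e f g), ?_⟩⟩
  rw [← integral_congr_ae (e f g)]
  rfl

lemma exists_aFormL {α σ : Eucl d → ℝ} (hα : MemLp α ⊤ (volume.restrict Ω))
    (hσ : MemLp σ ⊤ (volume.restrict Ω)) :
    ∃ A : H1 Ω →L[ℝ] H1 Ω →L[ℝ] ℝ, ∀ w v, A w v = aForm Ω α σ w v := by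
  obtain ⟨A, hA⟩ := exists_bilin_eq_integral_mul_inner (Y := Eucl d) hα
  obtain ⟨S, hS⟩ := exists_bilin_eq_integral_mul_inner (Y := ℝ) hσ
  obtain ⟨c, hc⟩ := exists_bilin_add_comp A S (gradL Ω) (fnL Ω)
  refine ⟨c, fun w v => ?_⟩
  have e : ∀ x, σ x * fn w x * fn v x = σ x * ⟪fn w x, fn v x⟫ := fun x => by
    rw [real_inner_eq_re_inner ℝ, RCLike.inner_apply]; simp; ring
  have h := integral_add (hA (grad w) (grad v)).1 (hS (fn w) (fn v)).1
  rw [← (hA (grad w) (grad v)).2, ← (hS (fn w) (fn v)).2] at h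
  rw [hc]
  simp only [aForm, e]
  exact h.symm

lemma exists_averageL {B : Set (Eucl d)} (hB : MeasurableSet B) (hBΩ : B ⊆ Ω)
    (hfin : volume B ≠ ⊤) : ∃ A : H1 Ω →L[ℝ] ℝ, ∀ v, A v = ⨍ x in B, fn v x := by
  have hfin' : (volume.restrict Ω) B ≠ ⊤ :=
    ((Measure.restrict_apply_le _ _).trans_lt hfin.lt_top).ne
  refine ⟨(volume.real B)⁻¹ • (innerSL ℝ (indicatorConstLp 2 hB hfin' (1 : ℝ))).comp (fnL Ω),
    fun v => ?_⟩
  have h := L2.inner_indicatorConstLp_one (𝕜 := ℝ) hB hfin' (fn v)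
  rw [Measure.restrict_restrict_of_subset hBΩ] at h
  rw [setAverage_eq, ← h]
  rfl

lemma exists_loadL {f : Eucl d → ℝ} (hf : MemLp f 2 (volume.restrict Ω)) :
    ∃ A : H1 Ω →L[ℝ] ℝ, ∀ v, A v = load Ω f v := by
  refine ⟨(innerSL ℝ (hf.toLp f)).comp (fnL Ω), fun v => ?_⟩
  change ⟪hf.toLp f, fn v⟫ = _
  rw [L2.inner_def, load]
  refine integral_congr_ae ?_
  filter_upwards [hf.coeFn_toLp] with x hx
  simp [hx, mul_comm]

lemma exists_cFormL {α σ : Eucl d → ℝ} (hα : MemLp α ⊤ (volume.restrict Ω))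
    (hσ : MemLp σ ⊤ (volume.restrict Ω)) {B : Fin m → Set (Eucl d)}
    (hB : ∀ i, MeasurableSet (B i)) (hBΩ : ∀ i, B i ⊆ Ω) (hfin : ∀ i, volume (B i) ≠ ⊤) (δ : ℝ) :
    ∃ c : H1 Ω →L[ℝ] H1 Ω →L[ℝ] ℝ, ∀ w v, c w v = cForm Ω α σ B δ w v := by
  obtain ⟨A, hA⟩ := exists_aFormL hα hσ
  choose M hM using fun i => exists_averageL (hB i) (hBΩ i) (hfin i)
  refine ⟨A + δ⁻¹ • ∑ i, volume.real (B i) •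
    (ContinuousLinearMap.mul ℝ ℝ).bilinearComp (M i) (M i), fun w v => ?_⟩
  simp [cForm, bForm, hA, hM, mul_assoc]

/-- The right-hand side is affine and continuous in the data `b`. -/
lemma exists_rhsL {f : Eucl d → ℝ} (hf : MemLp f 2 (volume.restrict Ω)) {B : Fin m → Set (Eucl d)}
    (hB : ∀ i, MeasurableSet (B i)) (hBΩ : ∀ i, B i ⊆ Ω) (hfin : ∀ i, volume (B i) ≠ ⊤) (δ : ℝ) :
    ∃ (l : H1 Ω →L[ℝ] ℝ) (T : EuclideanSpace ℝ (Fin m) →L[ℝ] H1 Ω →L[ℝ] ℝ),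
      ∀ b v, (l + T b) v = rhs Ω f B δ b v := by
  obtain ⟨l, hl⟩ := exists_loadL hf
  choose M hM using fun i => exists_averageL (hB i) (hBΩ i) (hfin i)
  refine ⟨l, δ⁻¹ • ∑ i, (EuclideanSpace.proj i : EuclideanSpace ℝ (Fin m) →L[ℝ] ℝ).smulRight
    (volume.real (B i) • M i), fun b v => ?_⟩
  simp [rhs, dataTerm, hl, hM, mul_assoc]

lemma cForm_comm (α σ : Eucl d → ℝ) (B : Fin m → Set (Eucl d)) (δ : ℝ) (w v : H1 Ω) :
    cForm Ω α σ B δ w v = cForm Ω α σ B δ v w := by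
  have h1 : aForm Ω α σ w v = aForm Ω α σ v w := by
    refine integral_congr_ae (Eventually.of_forall fun x => ?_)
    simp only [real_inner_comm (grad w x)]
    ring
  have h2 : bForm Ω B w v = bForm Ω B v w := Finset.sum_congr rfl fun i _ => by ring
  rw [cForm, cForm, h1, h2]

/-! ### Coercivity -/

lemma le_aForm_self {α σ : Eucl d → ℝ} {αmin : ℝ} (hα : MemLp α ⊤ (volume.restrict Ω))
    (hαmin : ∀ᵐ x ∂volume.restrict Ω, αmin ≤ α x) (hσ : MemLp σ ⊤ (volume.restrict Ω))
    (hσ0 : ∀ᵐ x ∂volume.restrict Ω, 0 ≤ σ x) (w : H1 Ω) :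
    αmin * ‖grad w‖ ^ 2 ≤ aForm Ω α σ w w := by
  obtain ⟨A, hA⟩ := exists_bilin_eq_integral_mul_inner (Y := Eucl d) hα
  obtain ⟨S, hS⟩ := exists_bilin_eq_integral_mul_inner (Y := ℝ) hσ
  have e : ∀ x, σ x * fn w x * fn w x = σ x * ⟪fn w x, fn w x⟫ := fun x => by
    rw [real_inner_eq_re_inner ℝ, RCLike.inner_apply]; simp; ring
  rw [← real_inner_self_eq_norm_sq, L2.inner_def, ← integral_const_mul]
  simp only [aForm, e]
  refine integral_mono_ae ((L2.integrable_inner _ _).const_mul _)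
    ((hA (grad w) (grad w)).1.add (hS (fn w) (fn w)).1) ?_
  filter_upwards [hαmin, hσ0] with x h1 h2
  have h3 : αmin * ⟪grad w x, grad w x⟫ ≤ α x * ⟪grad w x, grad w x⟫ :=
    mul_le_mul_of_nonneg_right h1 real_inner_self_nonneg
  have h4 : 0 ≤ σ x * ⟪fn w x, fn w x⟫ := mul_nonneg h2 real_inner_self_nonneg
  linarith

/-- Coercivity of `c̃`. The reaction coefficient may vanish, so the `L²` part of the norm is
recovered from the gradient and the mean over a single observation set. -/
theorem exists_coercive_cForm (hΩ : IsBoundedLipschitzDomain Ω) {α σ : Eucl d → ℝ} {αmin : ℝ}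
    (hαpos : 0 < αmin) (hα : MemLp α ⊤ (volume.restrict Ω))
    (hαmin : ∀ᵐ x ∂volume.restrict Ω, αmin ≤ α x) (hσ : MemLp σ ⊤ (volume.restrict Ω))
    (hσ0 : ∀ᵐ x ∂volume.restrict Ω, 0 ≤ σ x) {B : Fin m → Set (Eucl d)}
    (hB : ∀ i, IsOpen (B i)) (hBne : ∀ i, (B i).Nonempty) (hBΩ : ∀ i, B i ⊆ Ω) (i₀ : Fin m) {δ : ℝ}
    (hδ : 0 < δ) : ∃ κ > 0, ∀ w : H1 Ω, κ * ‖w‖ ^ 2 ≤ cForm Ω α σ B δ w w := by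
  obtain ⟨C, hC0, hC⟩ := hΩ.exists_norm_fn_sq_le (hB i₀) (hBne i₀) (hBΩ i₀)
  have hvol : 0 < volume.real (B i₀) := ENNReal.toReal_pos
    ((hB i₀).measure_pos volume (hBne i₀)).ne'
    (hΩ.isBounded.subset (hBΩ i₀)).measure_lt_top.ne
  set k := min αmin (δ⁻¹ * volume.real (B i₀))
  have hk : 0 < k := lt_min hαpos (by positivity)
  refine ⟨k / (C + 1), by positivity, fun w => ?_⟩
  set a := ⨍ x in B i₀, fn w x with ha
  have h1 : αmin * ‖grad w‖ ^ 2 ≤ aForm Ω α σ w w := le_aForm_self hα hαmin hσ hσ0 w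
  have h2 : volume.real (B i₀) * a ^ 2 ≤ bForm Ω B w w := by
    have := Finset.single_le_sum (s := Finset.univ)
      (f := fun i => volume.real (B i) * (⨍ x in B i, fn w x) * (⨍ x in B i, fn w x))
      (fun i _ => by rw [mul_assoc]; exact mul_nonneg measureReal_nonneg (mul_self_nonneg _))
      (Finset.mem_univ i₀)
    refine le_trans (le_of_eq ?_) this
    rw [ha]; ring
  have h3 : k * (‖grad w‖ ^ 2 + a ^ 2) ≤ cForm Ω α σ B δ w w := by
    have h4 : k * ‖grad w‖ ^ 2 ≤ αmin * ‖grad w‖ ^ 2 := by gcongr; exact min_le_left _ _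
    have h5 : k * a ^ 2 ≤ δ⁻¹ * volume.real (B i₀) * a ^ 2 := by gcongr; exact min_le_right _ _
    have h6 : δ⁻¹ * (volume.real (B i₀) * a ^ 2) ≤ δ⁻¹ * bForm Ω B w w := by gcongr
    rw [cForm]
    linarith
  have h7 : ‖w‖ ^ 2 ≤ (C + 1) * (‖grad w‖ ^ 2 + a ^ 2) := by
    rw [norm_sq_eq_fn_grad]
    have := hC w
    nlinarith [sq_nonneg a]
  calc k / (C + 1) * ‖w‖ ^ 2 ≤ k / (C + 1) * ((C + 1) * (‖grad w‖ ^ 2 + a ^ 2)) := by gcongr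
    _ = k * (‖grad w‖ ^ 2 + a ^ 2) := by field_simp
    _ ≤ _ := h3

end Concrete

end PDEReg

end

theorem mainTheorem7 {d m : ℕ} (hm : 1 ≤ m)
    (Ω : Set (PDEReg.Eucl d)) (hΩ : PDEReg.IsBoundedLipschitzDomain Ω)
    (V : Submodule ℝ (PDEReg.H1 Ω)) (hVclosed : IsClosed (V : Set (PDEReg.H1 Ω)))
    (hV : PDEReg.H10 Ω ≤ V)
    (α σ f : PDEReg.Eucl d → ℝ) (αmin αmax : ℝ) (hαmin : 0 < αmin)
    (hαmeas : AEStronglyMeasurable α (volume.restrict Ω))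
    (hα : ∀ᵐ x ∂(volume.restrict Ω), αmin ≤ α x ∧ α x ≤ αmax)
    (hσ : MemLp σ ⊤ (volume.restrict Ω))
    (hσnonneg : ∀ᵐ x ∂(volume.restrict Ω), 0 ≤ σ x)
    (hf : MemLp f 2 (volume.restrict Ω))
    (B : Fin m → Set (PDEReg.Eucl d)) (hBopen : ∀ i, IsOpen (B i))
    (hBnonempty : ∀ i, (B i).Nonempty) (hBsub : ∀ i, B i ⊆ Ω)
    (δ : ℝ) (hδ : 0 < δ) :
    (∀ b u, PDEReg.IsMinimizer Ω V α σ f B δ b u ↔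
      PDEReg.IsVariationalSolution Ω V α σ f B δ b u) ∧
    (∀ b, ∃! u, PDEReg.IsMinimizer Ω V α σ f B δ b u) ∧
    (∃ L : ℝ, 0 ≤ L ∧ ∀ b b' u u', PDEReg.IsMinimizer Ω V α σ f B δ b u →
      PDEReg.IsMinimizer Ω V α σ f B δ b' u' → ‖u - u'‖ ≤ L * ‖b - b'‖) := by
  have hαtop : MemLp α ⊤ (volume.restrict Ω) := by
    refine memLp_top_of_bound hαmeas αmax ?_
    filter_upwards [hα] with x hx
    rw [Real.norm_of_nonneg (hαmin.le.trans hx.1)]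
    exact hx.2
  have hBm := fun i => (hBopen i).measurableSet
  have hfin : ∀ i, volume (B i) ≠ ⊤ := fun i => (hΩ.isBounded.subset (hBsub i)).measure_lt_top.ne
  obtain ⟨c, hc⟩ := PDEReg.exists_cFormL hαtop hσ hBm hBsub hfin δ
  obtain ⟨l, T, hr⟩ := PDEReg.exists_rhsL hf hBm hBsub hfin δ
  obtain ⟨κ, hκ, hco⟩ := PDEReg.exists_coercive_cForm hΩ hαmin hαtop (hα.mono fun x hx => hx.1) hσ
    hσnonneg hBopen hBnonempty hBsub ⟨0, hm⟩ hδ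
  have h := PDEReg.quadratic_minimization_wellPosed hVclosed
    (fun w v => by rw [hc, hc, PDEReg.cForm_comm]) hκ (fun v => (hco v).trans_eq (hc v v).symm) l T
    (IsMin := PDEReg.IsMinimizer Ω V α σ f B δ)
    (fun b u => by simp only [PDEReg.IsMinimizer, PDEReg.energy, hc, hr])
  simpa only [PDEReg.IsVariationalSolution, hc, hr] using h
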